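/- Let $p\in[0,1]$ and $q\in[0,1]$. The elephant random walk with memory parameter $p$ and first-step parameter $q$ is the process $(S_n)_{n\ge 0}$ given by $S_0=0$ and $S_n=X_1+\dots+X_n$, where $X_1=1$ with probability $q$ and $X_1=-1$ with probability $1-q$, and, for every $n\ge 1$, $$X_{n+1}=\alpha_n X_{\beta_n}\quad\text{almost surely},$$ where $\beta_n$ is uniformly distributed on $\{1,\dots,n\}$, $\alpha_n=1$ with probability $p$ and $\alpha_n=-1$ with probability $1-p$, and $\alpha_n$, $\beta_n$ and $(X_1,\dots,X_n)$ are mutually independent. **Theorem.** If $0\le p<3/4$, then for every $q\in[0,1]$ $$\frac{S_n}{\sqrt n}\xrightarrow[n\to\infty]{\ \mathcal L\ }\mathcal N\Bigl(0,\frac{1}{3-4p}\Bigr),$$ that is, $S_n/\sqrt n$ converges in distribution to the centered Gaussian distribution with variance $1/(3-4p)$. -/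

import Mathlib

open MeasureTheory ProbabilityTheory Filter

/-- The Rademacher distribution `R(r)` on `ℝ`: mass `r` at `+1` and mass `1 - r` at `-1`
(a probability measure when `0 ≤ r ≤ 1`). -/
noncomputable def rademacher (r : ℝ) : Measure ℝ :=
  ENNReal.ofReal r • Measure.dirac 1 + ENNReal.ofReal (1 - r) • Measure.dirac (-1)

/-- `X 1, X 2, …` are the steps of an elephant random walk with memory parameter `p` and first-step
parameter `q`, on a probability space `(Ω, μ)`. The first step has the `R(q)` distribution; for
`n ≥ 1`, the time `β n` is chosen uniformly from `{1, …, n}`, the sign `α n` has the `R(p)`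
distribution, the history `(X 1, …, X n)`, the time `β n` and the sign `α n` are mutually
independent, and the next step is `α n * X (β n)`.
The values `X 0`, `α 0` and `β 0` play no role. -/
structure IsElephantRandomWalk {Ω : Type*} [MeasurableSpace Ω] (p q : ℝ) (μ : Measure Ω)
    (X : ℕ → Ω → ℝ) (α : ℕ → Ω → ℝ) (β : ℕ → Ω → ℕ) : Prop where
  /-- The steps are random variables. -/
  aemeasurable : ∀ n, 1 ≤ n → AEMeasurable (X n) μ
  /-- The first step goes right with probability `q` and left with probability `1 - q`. -/
  hasLaw_first : HasLaw (X 1) (rademacher q) μ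
  /-- The recalled time is uniform on `{1, …, n}`. -/
  hasLaw_time : ∀ n, 1 ≤ n → HasLaw (β n) (uniformOn (Set.Icc 1 n)) μ
  /-- The recalled step is repeated with probability `p` and reversed with probability `1 - p`. -/
  hasLaw_sign : ∀ n, 1 ≤ n → HasLaw (α n) (rademacher p) μ
  /-- The recalled time is independent of the history. -/
  indep_time : ∀ n, 1 ≤ n →
    IndepFun (β n) (fun ω (k : Finset.Icc 1 n) => X k ω) μ
  /-- The sign is independent of the recalled time and the history, jointly. -/
  indep_sign : ∀ n, 1 ≤ n →
    IndepFun (α n) (fun ω => (β n ω, fun (k : Finset.Icc 1 n) => X k ω)) μ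
  /-- The next step. -/
  step : ∀ n, 1 ≤ n → ∀ᵐ ω ∂μ, X (n + 1) ω = α n ω * X (β n ω) ω

/-- The position at time `n` of the walk with steps `X 1, X 2, …`, started at the origin. -/
def walkPosition {Ω : Type*} (X : ℕ → Ω → ℝ) (n : ℕ) (ω : Ω) : ℝ :=
  ∑ k ∈ Finset.Icc 1 n, X k ω

/-! The proof works directly with the characteristic functions φ_n(u) = E exp(iuS_n), without
martingales. Put a = 2p - 1 and L = 1/(3 - 4p). Given the past, the next step is ±1 with mean aS_n/n
(`integral_comp_mul_step`), so φ_{n+1}(u) = E[exp(iuS_n)(cos u + i sin u · aS_n/n)]. For small u the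
bracket is close to exp(-u²/2) exp(iu · aS_n/n). As E S_n² = O(n), this gives φ_{n+1}(u) =
exp(-u²/2) φ_n(u(1 + a/n)) + O(|u|³ + u²/n).

The Gaussian exp(-u²Ln/2) obeys the same recursion up to O(u²/n), precisely because L(1 - 2a) = 1.
Hence the distance between the two at time n + 1 is at most the distance at time n and argument u(1
+ a/n), plus the error (`norm_integral_exp_succ_sub_gaussian_le`).

In the normalized argument v = |u|√n this rescaling shrinks v by a factor at most 1 - c/(n + 1) with
c > 0, which is where p < 3/4 enters (`abs_one_add_div_mul_sqrt_le`). A bound d · v, linear in v,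
therefore turns the shrinking of v into a contraction of d. For bounded v the errors are o(1/n) · v,
and the harmonic series diverges, so d tends to 0 (`tendsto_zero_of_contracting`). -/

/-! ### Signs, recalled times and almost sure bounds. -/

lemma ae_rademacher_sq (r : ℝ) : ∀ᵐ x ∂(rademacher r), x ^ 2 = 1 := by
  rw [ae_iff, rademacher]
  simp

lemma integral_rademacher {r : ℝ} (h0 : 0 ≤ r) (h1 : r ≤ 1) :
    ∫ x, x ∂(rademacher r) = 2 * r - 1 := by
  have hi (c : ℝ) : Integrable (fun x : ℝ => x) (Measure.dirac c) :=
    integrable_dirac (by simp)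
  rw [rademacher, integral_add_measure ((hi _).smul_measure (by simp))
    ((hi _).smul_measure (by simp)), integral_smul_measure, integral_smul_measure]
  simp [ENNReal.toReal_ofReal h0, ENNReal.toReal_ofReal (sub_nonneg.2 h1)]
  ring

lemma walkPosition_succ {Ω : Type*} (X : ℕ → Ω → ℝ) (n : ℕ) (ω : Ω) :
    walkPosition X (n + 1) ω = walkPosition X n ω + X (n + 1) ω :=
  Finset.sum_Icc_succ_top (by omega) _

namespace IsElephantRandomWalk

variable {Ω : Type*} [MeasurableSpace Ω] {μ : Measure Ω} {p q : ℝ}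
  {X : ℕ → Ω → ℝ} {α : ℕ → Ω → ℝ} {β : ℕ → Ω → ℕ}

lemma ae_time_mem (hX : IsElephantRandomWalk p q μ X α β) {n : ℕ} (hn : 1 ≤ n) :
    ∀ᵐ ω ∂μ, β n ω ∈ Finset.Icc 1 n := by
  have h := (hX.hasLaw_time n hn).ae_iff (p := fun b => b ∈ Finset.Icc 1 n)
    (measurable_of_countable _)
  rw [h, ae_iff]
  have := isProbabilityMeasure_uniformOn (Set.finite_Icc 1 n) (Set.nonempty_Icc.2 hn)
  have h2 := prob_compl_eq_zero_iff (μ := uniformOn (Set.Icc 1 n)) (s := Set.Icc 1 n)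
    (MeasurableSet.of_discrete)
  have h3 := h2.2 (uniformOn_self (Set.finite_Icc 1 n) (Set.nonempty_Icc.2 hn))
  convert h3 using 2
  ext x
  simp

lemma measureReal_time_eq (hX : IsElephantRandomWalk p q μ X α β) {n k : ℕ}
    (hk : k ∈ Finset.Icc 1 n) : μ.real {ω | β n ω = k} = 1 / n := by
  have hn : 1 ≤ n := (Finset.mem_Icc.1 hk).1.trans (Finset.mem_Icc.1 hk).2
  rw [(hX.hasLaw_time n hn).measureReal_eq (p := fun b => b = k) MeasurableSet.of_discrete]
  have := uniformOn_apply_finset (s := Finset.Icc 1 n) (t := {k})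
  rw [measureReal_def]
  rw [Finset.coe_Icc] at this
  simp only [Set.ofPred_eq_eq_singleton]
  rw [Finset.coe_singleton] at this
  rw [this, Finset.inter_singleton_of_mem hk]
  simp

lemma aemeasurable_walkPosition (hX : IsElephantRandomWalk p q μ X α β) (n : ℕ) :
    AEMeasurable (walkPosition X n) μ := by
  unfold walkPosition
  exact Finset.aemeasurable_fun_sum _ fun k hk => hX.aemeasurable k (Finset.mem_Icc.1 hk).1

lemma ae_step_sq (hX : IsElephantRandomWalk p q μ X α β) (n : ℕ) (hn : 1 ≤ n) :
    ∀ᵐ ω ∂μ, X n ω ^ 2 = 1 := by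
  have hm : Measurable (fun x : ℝ => x ^ 2 = 1) := measurableSet_setOfPred.1 (by measurability)
  induction n using Nat.strong_induction_on with
  | _ n ih =>
    obtain rfl | hn' := hn.eq_or_lt
    · exact (hX.hasLaw_first.ae_iff hm).2 (ae_rademacher_sq q)
    obtain ⟨m, rfl⟩ := Nat.exists_eq_add_of_lt hn'
    have hm1 : 1 ≤ 1 + m := by omega
    have hall : ∀ᵐ ω ∂μ, ∀ k ∈ Finset.Icc 1 (1 + m), X k ω ^ 2 = 1 := by
      rw [Finset.eventually_all]
      intro k hk
      rw [Finset.mem_Icc] at hk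
      exact ih k (by omega) hk.1
    filter_upwards [hall, hX.step _ hm1, hX.ae_time_mem hm1,
      ((hX.hasLaw_sign _ hm1).ae_iff hm).2 (ae_rademacher_sq p)] with ω h1 h2 h3 h4
    rw [h2, mul_pow, h4, h1 _ h3, one_mul]

lemma ae_abs_step (hX : IsElephantRandomWalk p q μ X α β) (n : ℕ) (hn : 1 ≤ n) :
    ∀ᵐ ω ∂μ, |X n ω| = 1 := by
  filter_upwards [hX.ae_step_sq n hn] with ω h
  rwa [← sq_eq_sq₀ (abs_nonneg _) zero_le_one, sq_abs, one_pow]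

lemma ae_abs_walkPosition_le (hX : IsElephantRandomWalk p q μ X α β) (n : ℕ) :
    ∀ᵐ ω ∂μ, |walkPosition X n ω| ≤ n := by
  have hall : ∀ᵐ ω ∂μ, ∀ k ∈ Finset.Icc 1 n, |X k ω| = 1 := by
    rw [Finset.eventually_all]
    exact fun k hk => hX.ae_abs_step k (Finset.mem_Icc.1 hk).1
  filter_upwards [hall] with ω h
  calc |walkPosition X n ω| ≤ ∑ k ∈ Finset.Icc 1 n, |X k ω| := Finset.abs_sum_le_sum_abs _ _
    _ = n := by rw [Finset.sum_congr rfl h]; simp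

/-! ### Conditional mean and second moment. -/

lemma integrable_mul_step {𝕜 : Type*} [RCLike 𝕜] (hX : IsElephantRandomWalk p q μ X α β)
    {g : Ω → 𝕜} (hg : Integrable g μ) {k : ℕ} (hk : 1 ≤ k) :
    Integrable (fun ω => g ω * (X k ω : 𝕜)) μ := by
  refine hg.mul_bdd (c := 1) ?_ ?_
  · exact (RCLike.measurable_ofReal.comp_aemeasurable (hX.aemeasurable k hk)).aestronglyMeasurable
  · filter_upwards [hX.ae_abs_step k hk] with ω h
    simp [h]

/-- The conditional mean of the next step given the position `s` after `n` steps is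
`(2 * p - 1) * s / n`. -/
lemma integral_comp_mul_step {𝕜 : Type*} [RCLike 𝕜] (hX : IsElephantRandomWalk p q μ X α β)
    (hp0 : 0 ≤ p) (hp1 : p ≤ 1) {n : ℕ} (hn : 1 ≤ n) {f : ℝ → 𝕜} (hf : Measurable f)
    (hfi : Integrable (fun ω => f (walkPosition X n ω)) μ) :
    ∫ ω, f (walkPosition X n ω) * (X (n + 1) ω : 𝕜) ∂μ =
      ((2 * p - 1) / n : ℝ) * ∫ ω, f (walkPosition X n ω) * (walkPosition X n ω : 𝕜) ∂μ := by
  set H : Ω → (Finset.Icc 1 n → ℝ) := fun ω k => X k ω with hH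
  have hHm : AEMeasurable H μ := aemeasurable_pi_lambda _ fun k =>
    hX.aemeasurable k (Finset.mem_Icc.1 k.2).1
  have hS (ω : Ω) : walkPosition X n ω = ∑ k, H ω k := by
    rw [walkPosition, ← Finset.sum_coe_sort]
  have hβm := (hX.hasLaw_time n hn).aemeasurable
  let G : (Finset.Icc 1 n) → (Finset.Icc 1 n → ℝ) → 𝕜 := fun k h => f (∑ j, h j) * (h k : 𝕜)
  have hG (k) : Measurable (G k) := by
    refine (hf.comp (by fun_prop)).mul (RCLike.measurable_ofReal.comp (by fun_prop))
  have hGi (k) : Integrable (fun ω => G k (H ω)) μ := by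
    simp only [G, ← hS]
    exact hX.integrable_mul_step hfi (Finset.mem_Icc.1 k.2).1
  let e : ℕ → ℕ → 𝕜 := fun k b => if b = k then 1 else 0
  -- The recalled step is split over the possible values of `β n`. Independence then applies to each
  -- summand, and the average over `k` of the past steps is the position divided by `n`.
  let Y : ℕ × (Finset.Icc 1 n → ℝ) → 𝕜 := fun z => ∑ k : Finset.Icc 1 n, e k z.1 * G k z.2
  have hYm : Measurable Y := by
    refine Finset.measurable_fun_sum _ fun k _ => Measurable.mul ?_ ?_
    · exact (measurable_of_countable (e k)).comp measurable_fst
    · exact (hG k).comp measurable_snd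
  have hstep : (fun ω => f (walkPosition X n ω) * (X (n + 1) ω : 𝕜)) =ᵐ[μ]
      fun ω => (α n ω : 𝕜) * Y (β n ω, H ω) := by
    filter_upwards [hX.step n hn, hX.ae_time_mem hn] with ω h1 h2
    simp only [Y, e, G, ← hS, h1]
    rw [Finset.sum_eq_single ⟨β n ω, h2⟩]
    · simp [hH]; ring
    · intro k _ hk
      rw [if_neg, zero_mul]
      exact fun h => hk (Subtype.ext h.symm)
    · simp
  rw [integral_congr_ae hstep]
  rw [(hX.indep_sign n hn).integral_fun_comp_mul_comp (f := fun x : ℝ => (x : 𝕜)) (g := Y)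
    (hX.hasLaw_sign n hn).aemeasurable (hβm.prodMk hHm)
    RCLike.measurable_ofReal.aestronglyMeasurable hYm.aestronglyMeasurable]
  have hα : ∫ ω, (α n ω : 𝕜) ∂μ = ((2 * p - 1 : ℝ) : 𝕜) := by
    rw [integral_ofReal, (hX.hasLaw_sign n hn).integral_eq, integral_rademacher hp0 hp1]
  have hE (k : Finset.Icc 1 n) : ∫ ω, e k (β n ω) * G k (H ω) ∂μ =
      ((1 / n : ℝ) : 𝕜) * ∫ ω, G k (H ω) ∂μ := by
    rw [(hX.indep_time n hn).integral_fun_comp_mul_comp (f := e k) (g := G k) hβm hHm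
      (measurable_of_countable _).aestronglyMeasurable (hG k).aestronglyMeasurable]
    congr 1
    have h1 : (fun ω => e k (β n ω)) =
        fun ω => (((fun b : ℕ => if b = k then (1 : ℝ) else 0) (β n ω) : ℝ) : 𝕜) := by
      ext ω
      simp only [e]
      split_ifs <;> simp
    rw [h1, integral_ofReal, ← hX.measureReal_time_eq k.2]
    congr 1
    have h2 := (hX.hasLaw_time n hn).integral_comp
      (f := fun b : ℕ => if b = k then (1 : ℝ) else 0)
      (measurable_of_countable _).aestronglyMeasurable
    have h3 := (hX.hasLaw_time n hn).measureReal_eq (p := fun b => b = k) MeasurableSet.of_discrete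
    rw [h3, ← integral_indicator_one MeasurableSet.of_discrete]
    refine h2.trans (integral_congr_ae (.of_forall fun b => ?_))
    simp [Set.indicator_apply]
  have hei (k : Finset.Icc 1 n) : Integrable (fun ω => e k (β n ω) * G k (H ω)) μ := by
    refine (hGi k).bdd_mul (c := 1)
      ((measurable_of_countable (e k)).comp_aemeasurable hβm).aestronglyMeasurable
      (.of_forall fun ω => ?_)
    simp only [e]
    split_ifs <;> simp
  rw [hα]
  simp only [Y]
  rw [integral_finsetSum _ fun k _ => hei k, Finset.sum_congr rfl fun k _ => hE k,
    ← Finset.mul_sum, ← integral_finsetSum _ fun k _ => hGi k, ← mul_assoc, ← RCLike.ofReal_mul]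
  congr 1
  · congr 1; ring
  · congr 1
    ext ω
    simp only [G, ← hS, ← Finset.mul_sum]
    rw [hS ω]
    push_cast
    rfl

variable [IsProbabilityMeasure μ]

lemma integrable_comp_walkPosition {E : Type*} [NormedAddCommGroup E] [MeasurableSpace E]
    [BorelSpace E] [SecondCountableTopology E]
    (hX : IsElephantRandomWalk p q μ X α β) (n : ℕ) {f : ℝ → E} (hf : Continuous f) :
    Integrable (fun ω => f (walkPosition X n ω)) μ := by
  obtain ⟨C, hC⟩ := (isCompact_Icc (a := -(n : ℝ)) (b := n)).exists_bound_of_continuousOn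
    hf.continuousOn
  refine .of_bound (hf.measurable.comp_aemeasurable
    (hX.aemeasurable_walkPosition n)).aestronglyMeasurable C ?_
  filter_upwards [hX.ae_abs_walkPosition_le n] with ω h
  exact hC _ (abs_le.1 h)

lemma integral_walkPosition_sq_succ (hX : IsElephantRandomWalk p q μ X α β)
    (hp0 : 0 ≤ p) (hp1 : p ≤ 1) {n : ℕ} (hn : 1 ≤ n) :
    ∫ ω, walkPosition X (n + 1) ω ^ 2 ∂μ =
      (1 + 2 * (2 * p - 1) / n) * ∫ ω, walkPosition X n ω ^ 2 ∂μ + 1 := by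
  have h1 := hX.integral_comp_mul_step hp0 hp1 hn (f := fun x : ℝ => x) measurable_id
    (hX.integrable_comp_walkPosition n continuous_id)
  simp only [RCLike.ofReal_real_eq_id, id] at h1
  have hi : Integrable (fun ω => walkPosition X n ω ^ 2) μ :=
    hX.integrable_comp_walkPosition n (f := fun x : ℝ => x ^ 2) (by fun_prop)
  have hi' : Integrable (fun ω => walkPosition X n ω * X (n + 1) ω) μ :=
    hX.integrable_mul_step (𝕜 := ℝ)
      (hX.integrable_comp_walkPosition n continuous_id) (by omega : 1 ≤ n + 1)
  have : (fun ω => walkPosition X (n + 1) ω ^ 2) =ᵐ[μ] fun ω =>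
      walkPosition X n ω ^ 2 + 2 * (walkPosition X n ω * X (n + 1) ω) + 1 := by
    filter_upwards [hX.ae_step_sq (n + 1) (by omega)] with ω h
    rw [walkPosition_succ, ← h]
    ring
  rw [integral_congr_ae this, integral_add (by exact hi.add (hi'.const_mul 2)) (integrable_const _),
    integral_add hi (hi'.const_mul 2), integral_const_mul, h1]
  simp only [← pow_two, integral_const, probReal_univ, smul_eq_mul]
  ring

/-- In the diffusive regime the variance grows at most linearly. -/
lemma integral_walkPosition_sq_le (hX : IsElephantRandomWalk p q μ X α β)
    (hp0 : 0 ≤ p) (hp : p < 3 / 4) {n : ℕ} (hn : 1 ≤ n) :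
    ∫ ω, walkPosition X n ω ^ 2 ∂μ ≤ (1 + 1 / (3 - 4 * p)) * n := by
  have hδ : 0 < 3 - 4 * p := by linarith
  have hL : 0 < 1 / (3 - 4 * p) := by positivity
  induction n, hn using Nat.le_induction with
  | base =>
    have : (fun ω => walkPosition X 1 ω ^ 2) =ᵐ[μ] fun _ => 1 := by
      filter_upwards [hX.ae_step_sq 1 le_rfl] with ω h
      simpa [walkPosition] using h
    rw [integral_congr_ae this]
    simp only [integral_const, probReal_univ, smul_eq_mul, Nat.cast_one]
    linarith
  | succ n hn ih =>
    rw [hX.integral_walkPosition_sq_succ hp0 (by linarith) hn]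
    set V := ∫ ω, walkPosition X n ω ^ 2 ∂μ
    have hV : 0 ≤ V := integral_nonneg fun ω => sq_nonneg _
    have hn0 : (1 : ℝ) ≤ n := by exact_mod_cast hn
    push_cast
    -- The factor can be negative (`n = 1`, `p < 1/4`); the induction hypothesis is then not needed.
    by_cases h : 0 ≤ 1 + 2 * (2 * p - 1) / n
    · have h2 := mul_le_mul_of_nonneg_left ih h
      have h3 : (1 + 2 * (2 * p - 1) / n) * ((1 + 1 / (3 - 4 * p)) * n) =
        (1 + 1 / (3 - 4 * p)) * n + (1 + 1 / (3 - 4 * p)) * (2 * (2 * p - 1)) := by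
        field_simp
      have h4 : (1 + 1 / (3 - 4 * p)) * (2 * (2 * p - 1)) + 1 ≤ 1 + 1 / (3 - 4 * p) := by
        have : 1 / (3 - 4 * p) * (3 - 4 * p) = 1 := by field_simp
        nlinarith
      linarith
    · have := mul_nonpos_of_nonpos_of_nonneg (not_le.1 h).le hV
      nlinarith

end IsElephantRandomWalk

/-! ### Analytic estimates. -/

/-- The first two terms form the characteristic function at `u` of a ±1 variable with mean `y`. The
terms linear in `y` cancel up to order `|u| ^ 3`; what remains is quadratic in `y`, so a second
moment bound controls it. -/
lemma norm_cos_add_sin_mul_sub_exp_le {u y : ℝ} (hu : |u| ≤ 1) (hy : |y| ≤ 1) :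
    ‖(Real.cos u : ℂ) + Real.sin u * y * Complex.I -
      Real.exp (-u ^ 2 / 2) * Complex.exp (u * y * Complex.I)‖ ≤ 3 * |u| ^ 3 + u ^ 2 * y ^ 2 := by
  have hu0 := abs_nonneg u
  have hu2 : |u| ^ 2 = u ^ 2 := sq_abs u
  have h43 : |u| ^ 4 ≤ |u| ^ 3 := pow_le_pow_of_le_one hu0 hu (by norm_num)
  have h53 : |u| ^ 5 ≤ |u| ^ 3 := pow_le_pow_of_le_one hu0 hu (by norm_num)
  have hu3 : 0 ≤ |u| ^ 3 := by positivity
  set E := Real.exp (-u ^ 2 / 2) with hE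
  have hE0 : 0 ≤ E := (Real.exp_pos _).le
  have hE1 : E ≤ 1 := Real.exp_le_one_iff.2 (by nlinarith [sq_nonneg u])
  have hEl : 1 - u ^ 2 / 2 ≤ E := by
    have := Real.add_one_le_exp (-u ^ 2 / 2)
    linarith
  have hsq : u ^ 2 ≤ 1 := by rw [← hu2]; nlinarith
  have hEt : |E - 1 - -u ^ 2 / 2| ≤ |u| ^ 4 / 4 := by
    have h := Real.norm_exp_sub_one_sub_id_le (x := -u ^ 2 / 2) (by
      rw [Real.norm_eq_abs, abs_le]; constructor <;> nlinarith [sq_nonneg u])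
    rw [Real.norm_eq_abs, Real.norm_eq_abs, sq_abs] at h
    refine h.trans (le_of_eq ?_)
    rw [show |u| ^ 4 = (|u| ^ 2) ^ 2 by ring, hu2]
    ring
  have hcos : |Real.cos u - E| ≤ |u| ^ 3 := by
    have h := Real.cos_bound hu
    rw [abs_le] at h hEt ⊢
    constructor <;> linarith
  have hsin : |Real.sin u - u| ≤ |u| ^ 3 := by
    have h := Real.sin_bound hu
    have h1 : |u ^ 3| = |u| ^ 3 := abs_pow u 3
    have h2 := neg_abs_le (u ^ 3)
    have h3 := le_abs_self (u ^ 3)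
    rw [abs_le] at h ⊢
    constructor <;> linarith
  have hR : ‖Complex.exp (u * y * Complex.I) - 1 - u * y * Complex.I‖ ≤ u ^ 2 * y ^ 2 := by
    have hn : ‖(u * y * Complex.I : ℂ)‖ = |u| * |y| := by simp
    refine (Complex.norm_exp_sub_one_sub_id_le ?_).trans (le_of_eq ?_)
    · rw [hn]; exact mul_le_one₀ hu (abs_nonneg _) hy
    · rw [hn, mul_pow, sq_abs, sq_abs]
  have hdecomp : (Real.cos u : ℂ) + Real.sin u * y * Complex.I -
      E * Complex.exp (u * y * Complex.I) =
      ((Real.cos u - E : ℝ) : ℂ) + ((Real.sin u - u : ℝ) : ℂ) * y * Complex.I +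
        ((1 - E : ℝ) : ℂ) * u * y * Complex.I -
        E * (Complex.exp (u * y * Complex.I) - 1 - u * y * Complex.I) := by
    push_cast; ring
  rw [hdecomp]
  have n1 : ‖((Real.cos u - E : ℝ) : ℂ)‖ ≤ |u| ^ 3 := by
    rwa [Complex.norm_real, Real.norm_eq_abs]
  have n2 : ‖((Real.sin u - u : ℝ) : ℂ) * y * Complex.I‖ ≤ |u| ^ 3 := by
    rw [norm_mul, norm_mul, Complex.norm_I, mul_one, Complex.norm_real, Complex.norm_real,
      Real.norm_eq_abs, Real.norm_eq_abs]
    nlinarith [abs_nonneg y]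
  have n3 : ‖((1 - E : ℝ) : ℂ) * u * y * Complex.I‖ ≤ |u| ^ 3 := by
    rw [norm_mul, norm_mul, norm_mul, Complex.norm_I, mul_one, Complex.norm_real,
      Complex.norm_real, Complex.norm_real, Real.norm_eq_abs, Real.norm_eq_abs, Real.norm_eq_abs,
      abs_of_nonneg (by linarith)]
    calc (1 - E) * |u| * |y| ≤ (|u| ^ 2) * |u| * 1 := by
          gcongr
          nlinarith
      _ = |u| ^ 3 := by ring
  have n4 : ‖(E : ℂ) * (Complex.exp (u * y * Complex.I) - 1 - u * y * Complex.I)‖ ≤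
      u ^ 2 * y ^ 2 := by
    rw [norm_mul, Complex.norm_real, Real.norm_eq_abs, abs_of_nonneg hE0]
    exact (mul_le_of_le_one_left (norm_nonneg _) hE1).trans hR
  refine (norm_sub_le _ _).trans ?_
  have := norm_add₃_le (a := ((Real.cos u - E : ℝ) : ℂ))
    (b := ((Real.sin u - u : ℝ) : ℂ) * y * Complex.I)
    (c := ((1 - E : ℝ) : ℂ) * u * y * Complex.I)
  linarith

lemma abs_exp_neg_sub_exp_neg_le {x y : ℝ} (hx : 0 ≤ x) (hy : 0 ≤ y) :
    |Real.exp (-x) - Real.exp (-y)| ≤ |x - y| := by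
  wlog h : x ≤ y generalizing x y
  · rw [abs_sub_comm, abs_sub_comm x]
    exact this hy hx (not_le.1 h).le
  have h1 : Real.exp (-y) ≤ Real.exp (-x) := Real.exp_le_exp.2 (by linarith)
  rw [abs_of_nonneg (by linarith), abs_of_nonpos (by linarith)]
  have h2 := Real.add_one_le_exp (x - y)
  have h3 : Real.exp (-y) = Real.exp (-x) * Real.exp (x - y) := by rw [← Real.exp_add]; ring_nf
  have h4 : Real.exp (-x) ≤ 1 := Real.exp_le_one_iff.2 (by linarith)
  rw [h3]
  nlinarith [Real.exp_pos (-x)]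

/-- A sequence contracted by the factors `1 - c / (N + j + 1)` at step `j`, up to an error
`o(1 / j)`, tends to zero. -/
lemma tendsto_zero_of_contracting {d e : ℕ → ℝ} {c : ℝ} (hc : 0 < c) (N : ℕ)
    (hd : ∀ j, 0 ≤ d j) (he : Tendsto e atTop (nhds 0))
    (h : ∀ j, d (j + 1) ≤ (1 - c / (N + j + 1)) * d j + e j / (N + j + 1)) :
    Tendsto d atTop (nhds 0) := by
  rw [tendsto_order]
  refine ⟨fun a ha => .of_forall fun j => ha.trans_le (hd j), fun ε hε => ?_⟩
  -- The first condition makes `ε / 2` a level below which the recursion cannot push `d` back up;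
  -- the second keeps the contraction factors nonnegative.
  have hev : ∀ᶠ j : ℕ in atTop, e j ≤ c * (ε / 2) ∧ c ≤ (j : ℝ) :=
    (he.eventually_le_const (by positivity)).and (tendsto_natCast_atTop_atTop.eventually_ge_atTop c)
  obtain ⟨m, hm⟩ := eventually_atTop.1 hev
  let P : ℕ → ℝ := fun j => ∑ i ∈ Finset.range j, 1 / ((N + m + i : ℕ) + 1 : ℝ)
  have hP : Tendsto P atTop atTop := by
    have h1 := Real.tendsto_sum_range_one_div_nat_succ_atTop.comp
      (tendsto_add_atTop_nat (N + m))
    have h2 := tendsto_atTop_add_const_right atTop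
      (-∑ i ∈ Finset.range (N + m), 1 / ((i : ℝ) + 1) : ℝ) h1
    refine h2.congr fun j => ?_
    simp only [Function.comp, P]
    rw [add_comm j, Finset.sum_range_add]
    ring
  -- The excess over `ε / 2` is multiplied by at most `1 - x ≤ exp (-x)` at each step, and `P` is a
  -- tail of the harmonic series.
  have key (j : ℕ) : d (m + j) - ε / 2 ≤ |d m - ε / 2| * Real.exp (-(c * P j)) := by
    induction j with
    | zero => simpa [P] using le_abs_self (d m - ε / 2)
    | succ j ih =>
      obtain ⟨h1, h2⟩ := hm (m + j) (by omega)
      have h3 := h (m + j)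
      push_cast at h2 h3
      have hk : (0 : ℝ) < N + (m + j) + 1 := by positivity
      set x := c / ((N : ℝ) + (m + j) + 1) with hx
      have hx1 : x ≤ 1 := by
        rw [hx, div_le_one hk]
        have : (0 : ℝ) ≤ N := N.cast_nonneg
        linarith
      have h4 : e (m + j) / ((N : ℝ) + (m + j) + 1) ≤ x * (ε / 2) := by
        rw [hx, div_mul_eq_mul_div]
        gcongr
      have h5 : P (j + 1) = P j + 1 / ((N : ℝ) + (m + j) + 1) := by
        simp only [P]
        rw [Finset.sum_range_succ]
        push_cast
        ring
      have h6 : Real.exp (-(c * P (j + 1))) = Real.exp (-x) * Real.exp (-(c * P j)) := by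
        rw [← Real.exp_add, h5, hx]
        ring_nf
      have h7 : 1 - x ≤ Real.exp (-x) := by linarith [Real.add_one_le_exp (-x)]
      calc d (m + (j + 1)) - ε / 2 ≤ (1 - x) * (d (m + j) - ε / 2) := by
            rw [← add_assoc]; linarith
        _ ≤ (1 - x) * (|d m - ε / 2| * Real.exp (-(c * P j))) :=
            mul_le_mul_of_nonneg_left ih (by linarith)
        _ ≤ Real.exp (-x) * (|d m - ε / 2| * Real.exp (-(c * P j))) := by gcongr
        _ = _ := by rw [h6]; ring
  have hlim : Tendsto (fun j => |d m - ε / 2| * Real.exp (-(c * P j))) atTop (nhds 0) := by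
    have := (Real.tendsto_exp_neg_atTop_nhds_zero.comp (hP.const_mul_atTop hc)).const_mul
      |d m - ε / 2|
    simpa using this
  obtain ⟨J, hJ⟩ := eventually_atTop.1 (hlim.eventually_lt_const (half_pos hε))
  refine eventually_atTop.2 ⟨m + J, fun n hn => ?_⟩
  obtain ⟨j, rfl⟩ := Nat.exists_eq_add_of_le hn
  have h1 := key (J + j)
  have h2 := hJ (J + j) (by omega)
  rw [add_assoc]
  linarith

/-! ### One-step recursion for the characteristic function. -/

namespace IsElephantRandomWalk

variable {Ω : Type*} [MeasurableSpace Ω] {μ : Measure Ω} [IsProbabilityMeasure μ] {p q : ℝ}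
  {X : ℕ → Ω → ℝ} {α : ℕ → Ω → ℝ} {β : ℕ → Ω → ℕ}

/-- For `x = ±1`, exp(iux) = cos u + i x sin u is affine in `x`, so only the conditional mean of the
step is needed. -/
lemma integral_exp_walkPosition_succ (hX : IsElephantRandomWalk p q μ X α β)
    (hp0 : 0 ≤ p) (hp1 : p ≤ 1) {n : ℕ} (hn : 1 ≤ n) (u : ℝ) :
    ∫ ω, Complex.exp (u * walkPosition X (n + 1) ω * Complex.I) ∂μ =
      ∫ ω, Complex.exp (u * walkPosition X n ω * Complex.I) *
        (Real.cos u + Real.sin u * ((2 * p - 1) / n * walkPosition X n ω : ℝ) * Complex.I) ∂μ := by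
  set f : ℝ → ℂ := fun x => Complex.exp (u * x * Complex.I) with hf
  have hfc : Continuous f := by fun_prop
  have hfi := hX.integrable_comp_walkPosition n hfc
  have h1 : ∫ ω, f (walkPosition X n ω) * (X (n + 1) ω : ℂ) ∂μ = ((2 * p - 1) / n : ℝ) *
      ∫ ω, f (walkPosition X n ω) * (walkPosition X n ω : ℂ) ∂μ :=
    hX.integral_comp_mul_step hp0 hp1 hn hfc.measurable hfi
  have hi1 : Integrable (fun ω => f (walkPosition X n ω) * (X (n + 1) ω : ℂ)) μ :=
    hX.integrable_mul_step hfi (by omega : 1 ≤ n + 1)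
  have hi2 : Integrable (fun ω => f (walkPosition X n ω) * (walkPosition X n ω : ℂ)) μ :=
    hX.integrable_comp_walkPosition n (f := fun x : ℝ => f x * (x : ℂ)) (by fun_prop)
  have hae : (fun ω => Complex.exp (u * walkPosition X (n + 1) ω * Complex.I)) =ᵐ[μ] fun ω =>
      f (walkPosition X n ω) * Real.cos u +
        f (walkPosition X n ω) * (X (n + 1) ω : ℂ) * (Real.sin u * Complex.I) := by
    filter_upwards [hX.ae_step_sq (n + 1) (by omega)] with ω h
    rw [walkPosition_succ, hf]
    push_cast
    rw [mul_add, add_mul, Complex.exp_add]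
    rw [mul_assoc (Complex.exp _) (X (n + 1) ω : ℂ), ← mul_add]
    congr 1
    obtain h | h := sq_eq_one_iff.1 h
    · simp [h, Complex.exp_mul_I]
    · have : (u * (-1 : ℝ) * Complex.I : ℂ) = (-u : ℂ) * Complex.I := by push_cast; ring
      rw [h, this, Complex.exp_mul_I, Complex.cos_neg, Complex.sin_neg]
      push_cast
      ring
  rw [integral_congr_ae hae, integral_add (hfi.mul_const _) (hi1.mul_const _), integral_mul_const,
    integral_mul_const, h1]
  rw [← integral_mul_const, ← integral_const_mul, ← integral_mul_const,
    ← integral_add (hfi.mul_const _) ((hi2.const_mul _).mul_const _)]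
  congr 1
  ext ω
  simp only [hf]
  push_cast
  ring

/-- One step of the walk multiplies the characteristic function by a Gaussian factor and rescales
its argument, up to a small error. -/
lemma norm_integral_exp_walkPosition_succ_sub_le (hX : IsElephantRandomWalk p q μ X α β)
    (hp0 : 0 ≤ p) (hp : p < 3 / 4) {n : ℕ} (hn : 1 ≤ n) {u : ℝ} (hu : |u| ≤ 1) :
    ‖∫ ω, Complex.exp (u * walkPosition X (n + 1) ω * Complex.I) ∂μ - Real.exp (-u ^ 2 / 2) *
      ∫ ω, Complex.exp ((u * (1 + (2 * p - 1) / n) : ℝ) * walkPosition X n ω * Complex.I) ∂μ‖ ≤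
      3 * |u| ^ 3 + u ^ 2 * ((1 + 1 / (3 - 4 * p)) / n) := by
  have hn0 : (0 : ℝ) < n := by exact_mod_cast hn
  rw [hX.integral_exp_walkPosition_succ hp0 (by linarith) hn, ← integral_const_mul,
    ← integral_sub]
  rotate_left
  · exact hX.integrable_comp_walkPosition n (f := fun x : ℝ => Complex.exp (u * x * Complex.I) *
        (Real.cos u + Real.sin u * ((2 * p - 1) / n * x : ℝ) * Complex.I)) (by fun_prop)
  · exact hX.integrable_comp_walkPosition n (f := fun x : ℝ => (Real.exp (-u ^ 2 / 2) : ℂ) *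
        Complex.exp ((u * (1 + (2 * p - 1) / n) : ℝ) * x * Complex.I)) (by fun_prop)
  set S := walkPosition X n with hS
  have hSi : Integrable (fun ω => S ω ^ 2) μ :=
    hX.integrable_comp_walkPosition n (f := fun x : ℝ => x ^ 2) (by fun_prop)
  have ha : |2 * p - 1| ≤ 1 := by rw [abs_le]; constructor <;> linarith
  have hb : ∀ᵐ ω ∂μ, ‖Complex.exp (u * S ω * Complex.I) *
        (Real.cos u + Real.sin u * ((2 * p - 1) / n * S ω : ℝ) * Complex.I) -
      Real.exp (-u ^ 2 / 2) *
        Complex.exp ((u * (1 + (2 * p - 1) / n) : ℝ) * S ω * Complex.I)‖ ≤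
      3 * |u| ^ 3 + u ^ 2 / n ^ 2 * S ω ^ 2 := by
    filter_upwards [hX.ae_abs_walkPosition_le n] with ω h
    set y := (2 * p - 1) / n * S ω with hy
    have hy1 : |y| ≤ 1 := by
      rw [hy, abs_mul, abs_div, abs_of_pos hn0, div_mul_eq_mul_div, div_le_one hn0]
      nlinarith [abs_nonneg (S ω)]
    have hy2 : y ^ 2 ≤ S ω ^ 2 / n ^ 2 := by
      rw [hy, mul_pow, div_pow, div_mul_eq_mul_div]
      gcongr
      have : (2 * p - 1) ^ 2 ≤ 1 := by rw [← sq_abs]; nlinarith [abs_nonneg (2 * p - 1)]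
      nlinarith [sq_nonneg (S ω)]
    have e1 : Complex.exp ((u * (1 + (2 * p - 1) / n) : ℝ) * S ω * Complex.I) =
        Complex.exp (u * S ω * Complex.I) * Complex.exp (u * y * Complex.I) := by
      rw [← Complex.exp_add, hy]
      push_cast
      ring_nf
    have e2 : ‖Complex.exp (u * S ω * Complex.I)‖ = 1 := by
      have := Complex.norm_exp_ofReal_mul_I (u * S ω)
      simpa using this
    rw [e1, mul_left_comm, ← mul_sub, norm_mul, e2, one_mul]
    refine (norm_cos_add_sin_mul_sub_exp_le hu hy1).trans ?_
    have := mul_le_mul_of_nonneg_left hy2 (sq_nonneg u)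
    linarith [show u ^ 2 * (S ω ^ 2 / n ^ 2) = u ^ 2 / n ^ 2 * S ω ^ 2 by ring]
  refine (norm_integral_le_of_norm_le ((integrable_const _).add (hSi.const_mul _)) hb).trans ?_
  simp only [Pi.add_apply]
  rw [integral_add (integrable_const _) (hSi.const_mul _), integral_const,
    integral_const_mul (u ^ 2 / (n : ℝ) ^ 2), probReal_univ, one_smul]
  have h2 := mul_le_mul_of_nonneg_left (hX.integral_walkPosition_sq_le hp0 hp hn)
    (by positivity : 0 ≤ u ^ 2 / (n : ℝ) ^ 2)
  have h3 : u ^ 2 / (n : ℝ) ^ 2 * ((1 + 1 / (3 - 4 * p)) * n) =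
      u ^ 2 * ((1 + 1 / (3 - 4 * p)) / n) := by
    field_simp
  linarith

/-- Starting bound for the induction: the factor `n` is harmless at a fixed time, and linearity in
`|u|` is what matters. -/
lemma norm_integral_exp_walkPosition_sub_one_le (hX : IsElephantRandomWalk p q μ X α β) (n : ℕ)
    (u : ℝ) : ‖∫ ω, Complex.exp (u * walkPosition X n ω * Complex.I) ∂μ - 1‖ ≤ |u| * n := by
  have h1 : (1 : ℂ) = ∫ _, (1 : ℂ) ∂μ := by simp
  rw [h1, ← integral_sub (hX.integrable_comp_walkPosition n
    (f := fun x : ℝ => Complex.exp (u * x * Complex.I)) (by fun_prop)) (integrable_const _)]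
  refine (norm_integral_le_of_norm_le_const (C := |u| * n) ?_).trans (by simp)
  filter_upwards [hX.ae_abs_walkPosition_le n] with ω h
  have := Real.norm_exp_I_mul_ofReal_sub_one_le (x := u * walkPosition X n ω)
  rw [Real.norm_eq_abs, abs_mul] at this
  rw [mul_comm _ Complex.I, ← Complex.ofReal_mul]
  exact this.trans (by gcongr)

/-- The distance between the characteristic function after one step and the Gaussian one is
controlled by the same distance before the step, at the rescaled argument. -/
lemma norm_integral_exp_succ_sub_gaussian_le (hX : IsElephantRandomWalk p q μ X α β)
    (hp0 : 0 ≤ p) (hp : p < 3 / 4) {n : ℕ} (hn : 1 ≤ n) {u : ℝ} (hu : |u| ≤ 1) :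
    ‖∫ ω, Complex.exp (u * walkPosition X (n + 1) ω * Complex.I) ∂μ -
        Real.exp (-(u ^ 2 * (1 / (3 - 4 * p)) * (n + 1 : ℕ) / 2))‖ ≤
      ‖∫ ω, Complex.exp ((u * (1 + (2 * p - 1) / n) : ℝ) * walkPosition X n ω * Complex.I) ∂μ -
        Real.exp (-((u * (1 + (2 * p - 1) / n)) ^ 2 * (1 / (3 - 4 * p)) * n / 2))‖ +
      (3 * |u| ^ 3 + u ^ 2 * ((1 + 2 * (1 / (3 - 4 * p))) / n)) := by
  have hn0 : (0 : ℝ) < n := by exact_mod_cast hn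
  have hδ : 0 < 3 - 4 * p := by linarith
  have hLδ : 1 / (3 - 4 * p) * (3 - 4 * p) = 1 := by field_simp
  have h1 := hX.norm_integral_exp_walkPosition_succ_sub_le hp0 hp hn hu
  set L := 1 / (3 - 4 * p) with hL
  have hL0 : 0 < L := by positivity
  set w := u * (1 + (2 * p - 1) / n) with hw
  set A := ∫ ω, Complex.exp (u * walkPosition X (n + 1) ω * Complex.I) ∂μ
  set B := ∫ ω, Complex.exp (w * walkPosition X n ω * Complex.I) ∂μ
  set E := Real.exp (-u ^ 2 / 2) with hE
  set G := Real.exp (-(w ^ 2 * L * n / 2)) with hG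
  set G' := Real.exp (-(u ^ 2 * L * (n + 1 : ℕ) / 2)) with hG'
  have hE1 : E ≤ 1 := Real.exp_le_one_iff.2 (by nlinarith [sq_nonneg u])
  have h2 : |E * G - G'| ≤ u ^ 2 * (L / n) := by
    have e1 : E * G = Real.exp (-(u ^ 2 / 2 + w ^ 2 * L * n / 2)) := by
      rw [hE, hG, ← Real.exp_add]
      ring_nf
    rw [e1]
    refine (abs_exp_neg_sub_exp_neg_le (by positivity) (by positivity)).trans ?_
    -- The terms of order `u ^ 2` cancel by `L * (3 - 4 * p) = 1`, which singles out the limiting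
    -- variance.
    have e2 : u ^ 2 / 2 + w ^ 2 * L * n / 2 - u ^ 2 * L * (n + 1 : ℕ) / 2 =
        u ^ 2 * (L / n) * ((2 * p - 1) ^ 2 / 2) := by
      have e3 : w ^ 2 * L * n = u ^ 2 * L * (n + 2 * (2 * p - 1) + (2 * p - 1) ^ 2 / n) := by
        rw [hw]; field_simp; ring
      rw [e3]
      push_cast
      linear_combination (-(u ^ 2) / 2) * hLδ
    rw [e2, abs_of_nonneg (by positivity)]
    refine mul_le_of_le_one_right (by positivity) ?_
    nlinarith
  have h3 : ‖(E : ℂ) * (B - G)‖ ≤ ‖B - G‖ := by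
    rw [norm_mul, Complex.norm_real, Real.norm_eq_abs, abs_of_pos (Real.exp_pos _)]
    exact mul_le_of_le_one_left (norm_nonneg _) hE1
  have h4 : ‖((E * G - G' : ℝ) : ℂ)‖ ≤ u ^ 2 * (L / n) := by
    rwa [Complex.norm_real, Real.norm_eq_abs]
  have e : A - G' = (A - E * B) + E * (B - G) + ((E * G - G' : ℝ) : ℂ) := by
    push_cast; ring
  rw [e]
  refine norm_add₃_le.trans ?_
  have e5 : u ^ 2 * ((1 + L) / n) + u ^ 2 * (L / n) = u ^ 2 * ((1 + 2 * L) / n) := by ring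
  linarith

/-! ### Contraction in the normalized argument. -/

/-- With δ = 3 - 4p, the left side squared is n + 1 - δ + (2p - 1)²/n. Asking only for the rate δ/4
leaves room δ/2, which absorbs the last term once n ≥ 2/δ. -/
lemma abs_one_add_div_mul_sqrt_le {p : ℝ} (hp0 : 0 ≤ p) (hp : p < 3 / 4) {n : ℕ}
    (hn : 2 / (3 - 4 * p) ≤ n) :
    |1 + (2 * p - 1) / n| * √n ≤ (1 - (3 - 4 * p) / 4 / (n + 1)) * √(n + 1) := by
  have hδ : 0 < 3 - 4 * p := by linarith
  have hn0 : (0 : ℝ) < n := lt_of_lt_of_le (by positivity) hn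
  have hx : (3 - 4 * p) / 4 / ((n : ℝ) + 1) ≤ 1 := by
    rw [div_le_one (by positivity)]; linarith
  refine abs_le_of_sq_le_sq' ?_ (by have := Real.sqrt_nonneg ((n : ℝ) + 1); nlinarith) |>.2
  rw [mul_pow, mul_pow, sq_abs, Real.sq_sqrt hn0.le, Real.sq_sqrt (by positivity)]
  have e1 : (1 + (2 * p - 1) / n) ^ 2 * n = n + 2 * (2 * p - 1) + (2 * p - 1) ^ 2 / n := by
    field_simp; ring
  have e2 : (1 - (3 - 4 * p) / 4 / ((n : ℝ) + 1)) ^ 2 * (n + 1) =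
      n + 1 - (3 - 4 * p) / 2 + ((3 - 4 * p) / 4) ^ 2 / (n + 1) := by
    field_simp; ring
  have h3 : (2 * p - 1) ^ 2 / n ≤ (3 - 4 * p) / 2 := by
    rw [div_le_iff₀ hδ] at hn
    rw [div_le_iff₀ hn0]
    nlinarith
  have h4 : 0 ≤ ((3 - 4 * p) / 4) ^ 2 / ((n : ℝ) + 1) := by positivity
  rw [e1, e2]
  linarith

/-- On bounded sets of normalized arguments, the characteristic function of the walk is
asymptotically Gaussian. -/
lemma exists_norm_integral_exp_sub_gaussian_le (hX : IsElephantRandomWalk p q μ X α β)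
    (hp0 : 0 ≤ p) (hp : p < 3 / 4) {T : ℝ} (hT : 0 ≤ T) :
    ∃ (N : ℕ) (d : ℕ → ℝ), Tendsto d atTop (nhds 0) ∧ ∀ (j : ℕ) (u : ℝ),
      |u| * √(N + j : ℕ) ≤ T →
      ‖∫ ω, Complex.exp (u * walkPosition X (N + j) ω * Complex.I) ∂μ -
        Real.exp (-(u ^ 2 * (1 / (3 - 4 * p)) * (N + j : ℕ) / 2))‖ ≤
      d j * (|u| * √(N + j : ℕ)) := by
  have hδ : 0 < 3 - 4 * p := by linarith
  set L := 1 / (3 - 4 * p) with hL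
  have hL0 : 0 < L := by positivity
  -- The three summands give the contraction, `|u| ≤ 1` whenever the normalized argument is at most
  -- `T`, and `1 ≤ N`.
  obtain ⟨N, hN⟩ := exists_nat_ge (2 / (3 - 4 * p) + T ^ 2 + 1)
  have hδ2 : 0 < 2 / (3 - 4 * p) := by positivity
  have hN1 : (1 : ℝ) ≤ N := by nlinarith [sq_nonneg T]
  set c := (3 - 4 * p) / 4 with hc
  have hc0 : 0 < c := by positivity
  -- These are the one-step errors after substituting `|u| ≤ T / √(N + j + 1)` and factoring out
  -- `|u| * √(N + j + 1) / (N + j + 1)`.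
  let e : ℕ → ℝ := fun j => 3 * T ^ 2 / √(N + j + 1) + T * (1 + 2 * L) / (N + j)
  have he0 (j) : 0 ≤ e j := by positivity
  have he : Tendsto e atTop (nhds 0) := by
    have t1 : Tendsto (fun j : ℕ => (N : ℝ) + j) atTop atTop :=
      tendsto_atTop_add_const_left atTop (N : ℝ) tendsto_natCast_atTop_atTop
    have t2 : Tendsto (fun j : ℕ => (N : ℝ) + j + 1) atTop atTop :=
      tendsto_atTop_add_const_right atTop (1 : ℝ) t1
    have t3 := (Real.tendsto_sqrt_atTop.comp t2).const_div_atTop (3 * T ^ 2)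
    simpa using t3.add (t1.const_div_atTop (T * (1 + 2 * L)))
  -- In the initial value, `√N` bounds the distance of the characteristic function from 1, and `T *
  -- L / 2` that of the Gaussian.
  let d : ℕ → ℝ := fun j => Nat.rec (√N + T * L / 2)
    (fun j x => (1 - c / (N + j + 1)) * x + e j / (N + j + 1)) j
  have hds (j : ℕ) : d (j + 1) = (1 - c / (N + j + 1)) * d j + e j / (N + j + 1) := rfl
  have hcj (j : ℕ) : 0 ≤ 1 - c / ((N : ℝ) + j + 1) := by
    have : c / ((N : ℝ) + j + 1) ≤ 1 := by
      rw [div_le_one (by positivity)]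
      have : (0 : ℝ) ≤ j := j.cast_nonneg
      linarith
    linarith
  have hd0 (j : ℕ) : 0 ≤ d j := by
    induction j with
    | zero => show 0 ≤ √N + T * L / 2; positivity
    | succ j ih =>
      rw [hds]
      have := mul_nonneg (hcj j) ih
      have := he0 j
      positivity
  refine ⟨N, d, tendsto_zero_of_contracting hc0 N hd0 he fun j => (hds j).le, fun j => ?_⟩
  induction j with
  | zero =>
    intro u hu
    rw [add_zero] at hu ⊢
    have h1 := hX.norm_integral_exp_walkPosition_sub_one_le N u
    have hsN : √(N : ℝ) ^ 2 = N := Real.sq_sqrt (by positivity)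
    have h2 := abs_exp_neg_sub_exp_neg_le (x := 0) (y := u ^ 2 * L * N / 2) le_rfl (by positivity)
    rw [neg_zero, Real.exp_zero, zero_sub, abs_neg,
      abs_of_nonneg (by positivity : 0 ≤ u ^ 2 * L * N / 2)] at h2
    have h3 : u ^ 2 * L * N / 2 ≤ T * L / 2 * (|u| * √N) := by
      have : u ^ 2 * L * N / 2 = (|u| * √N) * L / 2 * (|u| * √N) := by
        rw [← sq_abs u]
        linear_combination (-(|u| ^ 2 * L / 2)) * hsN
      rw [this]
      gcongr
    have h4 : |u| * N = √N * (|u| * √N) := by linear_combination (-|u|) * hsN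
    show _ ≤ (√N + T * L / 2) * _
    calc _ ≤ ‖∫ ω, Complex.exp (u * walkPosition X N ω * Complex.I) ∂μ - 1‖ +
          ‖((1 - Real.exp (-(u ^ 2 * L * N / 2)) : ℝ) : ℂ)‖ := by
          refine le_trans (le_of_eq ?_) (norm_add_le _ _)
          congr 1
          push_cast
          ring
      _ ≤ √N * (|u| * √N) + T * L / 2 * (|u| * √N) := by
          rw [Complex.norm_real, Real.norm_eq_abs, ← h4]
          exact add_le_add h1 (h2.trans h3)
      _ = _ := by ring
  | succ j ih =>
    intro u hu
    have hn : 1 ≤ N + j := by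
      have : 1 ≤ N := by exact_mod_cast hN1
      omega
    have hj0 : (0 : ℝ) ≤ j := j.cast_nonneg
    have hcast : ((N + (j + 1) : ℕ) : ℝ) = (N + j : ℕ) + 1 := by push_cast; ring
    have hcast' : ((N + j : ℕ) : ℝ) = N + j := by push_cast; ring
    have hn2 : 2 / (3 - 4 * p) ≤ (N + j : ℕ) := by
      rw [hcast']; linarith [sq_nonneg T]
    set s := √((N + j : ℕ) + 1 : ℝ) with hs
    have hs2 : s ^ 2 = N + j + 1 := by rw [hs, Real.sq_sqrt (by positivity), hcast']
    have hs0 : 0 < s := Real.sqrt_pos.2 (by positivity)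
    have hTs : T ≤ s := Real.le_sqrt_of_sq_le (by rw [hcast']; linarith)
    rw [hcast, ← hs] at hu
    have hu1 : |u| ≤ 1 := by
      by_contra hlt
      push Not at hlt
      nlinarith
    have h1 := hX.norm_integral_exp_succ_sub_gaussian_le hp0 hp hn hu1
    have h2 := abs_one_add_div_mul_sqrt_le hp0 hp hn2
    rw [← hs, ← hc, hcast', ← hcast'] at h2
    set w := u * (1 + (2 * p - 1) / (N + j : ℕ)) with hw
    have h3 : |w| * √(N + j : ℕ) ≤ (1 - c / (N + j + 1)) * (|u| * s) := by
      rw [hw, abs_mul, mul_assoc]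
      refine (mul_le_mul_of_nonneg_left h2 (abs_nonneg u)).trans (le_of_eq ?_)
      rw [hcast']
      ring
    have hc1 : 1 - c / ((N : ℝ) + j + 1) ≤ 1 := by
      have : 0 ≤ c / ((N : ℝ) + j + 1) := by positivity
      linarith
    have hv0 : 0 ≤ |u| * s := by positivity
    have h4 : |w| * √(N + j : ℕ) ≤ T :=
      h3.trans ((mul_le_of_le_one_left hv0 hc1).trans hu)
    -- The induction hypothesis is used at the rescaled argument `w`, so it has to cover all
    -- admissible arguments at once.
    have h5 := (ih w h4).trans (mul_le_mul_of_nonneg_left h3 (hd0 j))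
    have h6 : 3 * |u| ^ 3 ≤ 3 * T ^ 2 / s / (N + j + 1) * (|u| * s) := by
      rw [← hs2, div_div, div_mul_eq_mul_div, le_div_iff₀ (by positivity)]
      have : (|u| * s) ^ 2 ≤ T ^ 2 := by gcongr
      calc 3 * |u| ^ 3 * (s * s ^ 2) = 3 * (|u| * s) ^ 2 * (|u| * s) := by ring
        _ ≤ _ := by gcongr
    have h7 : u ^ 2 * ((1 + 2 * L) / (N + j : ℕ)) ≤
        T * (1 + 2 * L) / (N + j) / (N + j + 1) * (|u| * s) := by
      have hpos : (0 : ℝ) < N + j := by linarith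
      rw [hcast', ← hs2, div_div, div_mul_eq_mul_div, le_div_iff₀ (by positivity), ← sq_abs u]
      calc |u| ^ 2 * ((1 + 2 * L) / (N + j)) * ((N + j) * s ^ 2) =
            (|u| * s) * (1 + 2 * L) * (|u| * s) := by field_simp
        _ ≤ _ := by gcongr
    have h8 : d (j + 1) * (|u| * s) = d j * ((1 - c / (N + j + 1)) * (|u| * s)) +
        (3 * T ^ 2 / s / (N + j + 1) * (|u| * s) +
          T * (1 + 2 * L) / (N + j) / (N + j + 1) * (|u| * s)) := by
      rw [hds]
      simp only [e]
      rw [hs, hcast']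
      ring
    rw [hcast, ← hs, h8, ← hcast]
    exact h1.trans (add_le_add h5 (add_le_add h6 h7))

end IsElephantRandomWalk

/-! ### Conclusion by Lévy's continuity theorem. -/

theorem theorem3p3 {Ω : Type*} [MeasurableSpace Ω] (μ : Measure Ω) [IsProbabilityMeasure μ]
    (p q : ℝ) (hp0 : 0 ≤ p) (hp : p < 3 / 4) (hq0 : 0 ≤ q) (hq1 : q ≤ 1)
    (X : ℕ → Ω → ℝ) (α : ℕ → Ω → ℝ) (β : ℕ → Ω → ℕ)
    (hX : IsElephantRandomWalk p q μ X α β) :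
    TendstoInDistribution (fun (n : ℕ) (ω : Ω) => walkPosition X n ω / √(n : ℝ)) atTop
      (id : ℝ → ℝ) (fun _ => μ) (gaussianReal 0 (1 / (3 - 4 * p)).toNNReal) := by
  have hm (n : ℕ) : AEMeasurable (fun ω => walkPosition X n ω / √(n : ℝ)) μ :=
    (hX.aemeasurable_walkPosition n).div_const _
  refine ⟨hm, aemeasurable_id, ?_⟩
  refine ProbabilityMeasure.tendsto_iff_tendsto_charFun.2 fun t => ?_
  have hL0 : 0 ≤ 1 / (3 - 4 * p) := by
    have : 0 < 3 - 4 * p := by linarith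
    positivity
  obtain ⟨N, d, hd, h⟩ := hX.exists_norm_integral_exp_sub_gaussian_le hp0 hp (abs_nonneg t)
  simp only [ProbabilityMeasure.coe_mk, Measure.map_id, charFun_gaussianReal]
  -- Shifting by `N + 1` rather than `N` keeps the time positive, so that `t / √n` has normalized
  -- argument exactly `|t|`.
  rw [← tendsto_add_atTop_iff_nat (N + 1), tendsto_iff_norm_sub_tendsto_zero]
  have hd' : Tendsto (fun j => d (j + 1) * |t|) atTop (nhds 0) := by
    simpa using ((tendsto_add_atTop_iff_nat 1).2 hd).mul_const |t|
  refine squeeze_zero (fun _ => norm_nonneg _) (fun j => ?_) hd'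
  have e0 : j + (N + 1) = N + (j + 1) := by omega
  rw [e0, charFun_apply_real, integral_map (hm _) (by fun_prop)]
  have hs0 : 0 < √(N + (j + 1) : ℕ) := Real.sqrt_pos.2 (by positivity)
  have hs2 : √(N + (j + 1) : ℕ) ^ 2 = (N + (j + 1) : ℕ) := Real.sq_sqrt (by positivity)
  have e1 : |t / √(N + (j + 1) : ℕ)| * √(N + (j + 1) : ℕ) = |t| := by
    rw [abs_div, abs_of_pos hs0, div_mul_cancel₀ _ hs0.ne']
  have h1 := h (j + 1) (t / √(N + (j + 1) : ℕ)) e1.le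
  rw [e1] at h1
  refine le_trans (le_of_eq ?_) h1
  congr 2
  · congr 1
    ext ω
    congr 1
    push_cast
    ring
  · have e2 : (t / √(N + (j + 1) : ℕ)) ^ 2 * (1 / (3 - 4 * p)) * (N + (j + 1) : ℕ) / 2 =
        1 / (3 - 4 * p) * t ^ 2 / 2 := by
      rw [div_pow, hs2]
      have : ((N + (j + 1) : ℕ) : ℝ) ≠ 0 := by positivity
      generalize 1 / (3 - 4 * p) = L
      field_simp
    rw [e2, Complex.ofReal_exp, Real.coe_toNNReal _ hL0]
    push_cast
    ring_nf
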